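/- Let $\mathsf X,\mathsf A$ be finite sets, $\mathcal H_{\mathsf X}=\mathbb C^{\mathsf X}$ and $\mathcal H_{\mathsf A}=\mathbb C^{\mathsf A}$ with fixed orthonormal bases $\{|x\rangle\}$, $\{|a\rangle\}$. A density operator is a positive semidefinite operator of trace one; a quantum channel is a completely positive, trace-preserving linear map; $\langle A,B\rangle=\mathrm{Tr}(AB)$ for Hermitian $A,B$. Consider a quantum Markov decision process given by a quantum channel $\mathcal N$ from $\mathcal H_{\mathsf X}\otimes\mathcal H_{\mathsf A}$ to $\mathcal H_{\mathsf X}$ (the transition), a Hermitian cost operator $c$ on $\mathcal H_{\mathsf X}\otimes\mathcal H_{\mathsf A}$ and a discount factor $\beta\in(0,1)$. Let $C_w$ be the set of quantum channels $\gamma$ from $\mathcal H_{\mathsf X}$ to $\mathcal H_{\mathsf X}\otimes\mathcal H_{\mathsf A}$ with $\mathrm{Tr}_{\mathsf A}\,\gamma(|x\rangle\langle x|)=|x\rangle\langle x|$ for all $x\in\mathsf X$. A classical-state-preserving closed-loop policy is a sequence $\boldsymbol\gamma=\{\gamma_t\}_{t\ge 0}$ in $C_w$; it is stationary if $\gamma_t=\gamma$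 for all $t$. From an initial density operator $\rho_0$ it generates $\sigma_t=\gamma_t(\rho_t)$, $\rho_{t+1}=\mathcal N(\sigma_t)$, with cost $V(\boldsymbol\gamma,\rho_0)=\sum_{t\ge 0}\beta^t\langle c,\sigma_t\rangle$. Let $V_w^*(\rho_0)$ be the infimum of $V(\boldsymbol\gamma,\rho_0)$ over all such policies; a policy is optimal for $\rho_0$ if it attains this infimum. Let $\mathcal N_{qc}(\rho)=\sum_{x}\mathrm{Tr}(\rho|x\rangle\langle x|)\,|x\rangle\langle x|$ and let $\mathcal N^\dagger$ be the Hilbert–Schmidt adjoint of $\mathcal N$. Assume that there is a Hermitian operator $\xi^*$ on $\mathcal H_{\mathsf X}$ such that $$c+\beta\,\mathcal N^\dagger(\mathcal N_{qc}(\xi^*))\succcurlyeq \mathcal N_{qc}(\xi^*)\otimes \mathrm{Id}$$ and, for every density operator $\rho$ on $\mathcal H_{\mathsf X}$, $$\min_{\gamma\in C_w}\langle c+\beta\,\mathcal N^\dagger(\mathcal N_{qc}(\xi^*)),\gamma(\rho)\rangle=\langle\mathcal N_{qc}(\xi^*),\rho\rangle .$$ **Theorem.** For every such $\xi^*$: 1.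 $V_w^*(\rho)=\langle\mathcal N_{qc}(\xi^*),\rho\rangle$ for every density operator $\rho$ on $\mathcal H_{\mathsf X}$. 2. $C_w$ is convex and compact. 3. For every initial density operator $\rho_0$ there is $\gamma^*\in C_w$ such that the stationary policy $\{\gamma^*\}$ is optimal for $\rho_0$ among all classical-state-preserving closed-loop policies, and such that $\gamma^*$ is a fixed point of the following set-valued map $R_w$ on $C_w$, that is, $\gamma^*\in R_w(\gamma^*)$: $$R_w(\gamma)=\operatorname*{arg\,min}_{\tilde\gamma\in C_w}\bigl[\langle c,\tilde\gamma(\rho^{\gamma})\rangle+\beta\langle\mathcal N_{qc}(\xi^*),\mathcal N(\tilde\gamma(\rho^{\gamma}))\rangle\bigr],\qquad \rho^\gamma=\sum_{t\ge0}(1-\beta)\beta^t\rho_t^\gamma,$$ where $\rho_0^\gamma=\rho_0$ and $\rho_{t+1}^\gamma=\mathcal N(\gamma(\rho_t^\gamma))$. -/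

import Mathlib

open scoped Kronecker ComplexOrder

noncomputable section

namespace QMDP

/-- Density operators: positive semidefinite matrices of trace one. -/
def IsDensity {n : Type*} [Fintype n] (ρ : Matrix n n ℂ) : Prop :=
  ρ.PosSemidef ∧ ρ.trace = 1

/-- The Hilbert-Schmidt pairing `⟨A, B⟩ = Tr (A B)` of Hermitian matrices. For Hermitian arguments
the trace is real; taking the real part only makes the value a real number. -/
def pairing {n : Type*} [Fintype n] (A B : Matrix n n ℂ) : ℝ :=
  (A * B).trace.re

/-- The super-operator `Φ ⊗ id` for an environment of dimension `k`. -/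
def ampliation {n m : Type*} (Φ : Matrix n n ℂ →ₗ[ℂ] Matrix m m ℂ) (k : ℕ)
    (M : Matrix (n × Fin k) (n × Fin k) ℂ) : Matrix (m × Fin k) (m × Fin k) ℂ :=
  Matrix.of fun p q => Φ (Matrix.of fun i j => M (i, p.2) (j, q.2)) p.1 q.1

/-- Quantum channels: completely positive and trace preserving super-operators. -/
structure IsChannel {n m : Type*} [Fintype n] [Fintype m]
    (Φ : Matrix n n ℂ →ₗ[ℂ] Matrix m m ℂ) : Prop where
  completelyPositive : ∀ (k : ℕ) (M : Matrix (n × Fin k) (n × Fin k) ℂ),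
    M.PosSemidef → (ampliation Φ k M).PosSemidef
  tracePreserving : ∀ M : Matrix n n ℂ, (Φ M).trace = M.trace

open scoped MatrixOrder Matrix.Norms.L2Operator in
theorem IsDensity.norm_apply_le {n : Type*} [Fintype n] {ρ : Matrix n n ℂ} (h : IsDensity ρ)
    (i j : n) : ‖ρ i j‖ ≤ 1 := by
  classical
  obtain ⟨B, hB⟩ := CStarAlgebra.nonneg_iff_eq_star_mul_self.mp h.1.nonneg
  have e : ∀ i j, ρ i j = ∑ k, star (B k i) * B k j := by
    intro i j; rw [hB]; simp [Matrix.mul_apply, Matrix.star_apply]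
  have d : ∀ i, ∑ k, ‖B k i‖ ^ 2 = (ρ i i).re := by
    intro i
    rw [e, Complex.re_sum]
    refine Finset.sum_congr rfl fun k _ => ?_
    rw [← Complex.normSq_eq_norm_sq, mul_comm]
    simp [Complex.normSq_apply]
  have d0 : ∀ i, 0 ≤ (ρ i i).re := fun i => by rw [← d]; positivity
  have t : ∑ i, (ρ i i).re = 1 := by
    have := congrArg Complex.re h.2
    simpa [Matrix.trace] using this
  have d1 : ∀ i, (ρ i i).re ≤ 1 := fun i => by
    rw [← t]; exact Finset.single_le_sum (fun i _ => d0 i) (Finset.mem_univ i)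
  calc ‖ρ i j‖ ≤ ∑ k, ‖B k i‖ * ‖B k j‖ := by
        rw [e]; refine (norm_sum_le _ _).trans (le_of_eq ?_); simp
    _ ≤ ∑ k, (‖B k i‖ ^ 2 + ‖B k j‖ ^ 2) / 2 := by
        gcongr with k; nlinarith [sq_nonneg (‖B k i‖ - ‖B k j‖)]
    _ = ((ρ i i).re + (ρ j j).re) / 2 := by
        rw [← Finset.sum_div, Finset.sum_add_distrib, d, d]
    _ ≤ 1 := by linarith [d1 i, d1 j]

theorem IsChannel.isDensity {n m : Type*} [Fintype n] [Fintype m]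
    {Φ : Matrix n n ℂ →ₗ[ℂ] Matrix m m ℂ} (hΦ : IsChannel Φ) {ρ : Matrix n n ℂ}
    (h : IsDensity ρ) : IsDensity (Φ ρ) := by
  refine ⟨?_, by rw [hΦ.tracePreserving, h.2]⟩
  have := hΦ.completelyPositive 1 (ρ.submatrix Prod.fst Prod.fst) (h.1.submatrix _)
  exact this.submatrix (fun i => (i, (0 : Fin 1)))

/-- The Hilbert-Schmidt adjoint `Φ†` of a super-operator, given by its entries
`⟨E i j, Φ† ξ⟩ = ⟨Φ (E i j), ξ⟩` on the matrix units `E i j`. -/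
def adjoint {n m : Type*} [DecidableEq n] [Fintype m]
    (Φ : Matrix n n ℂ →ₗ[ℂ] Matrix m m ℂ) (ξ : Matrix m m ℂ) : Matrix n n ℂ :=
  Matrix.of fun i j => ((Φ (Matrix.single i j 1)).conjTranspose * ξ).trace

/-- The defining identity `⟨Φ† ξ, σ⟩ = ⟨ξ, Φ σ⟩` of the adjoint. -/
theorem trace_adjoint {n m : Type*} [Fintype n] [DecidableEq n] [Fintype m]
    (Φ : Matrix n n ℂ →ₗ[ℂ] Matrix m m ℂ) (ξ : Matrix m m ℂ) (σ : Matrix n n ℂ) :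
    ((adjoint Φ ξ).conjTranspose * σ).trace = (ξ.conjTranspose * Φ σ).trace := by
  have h : ∀ i j, star (adjoint Φ ξ i j) = (ξ.conjTranspose * Φ (Matrix.single i j 1)).trace := by
    intro i j
    rw [adjoint, Matrix.of_apply, ← Matrix.trace_conjTranspose, Matrix.conjTranspose_mul,
      Matrix.conjTranspose_conjTranspose]
  have e : Φ σ = ∑ i, ∑ j, σ i j • Φ (Matrix.single i j 1) := by
    conv_lhs => rw [Matrix.matrix_eq_sum_single σ]
    simp only [map_sum]
    refine Finset.sum_congr rfl fun i _ => Finset.sum_congr rfl fun j _ => ?_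
    rw [← map_smul, Matrix.smul_single, smul_eq_mul, mul_one]
  rw [e]
  simp only [Matrix.mul_sum, Matrix.mul_smul, Matrix.trace_sum, Matrix.trace_smul, smul_eq_mul,
    ← h]
  simp only [Matrix.trace, Matrix.diag_apply, Matrix.mul_apply, Matrix.conjTranspose_apply]
  rw [Finset.sum_comm]
  exact Finset.sum_congr rfl fun i _ => Finset.sum_congr rfl fun j _ => mul_comm _ _

/-- The rank-one projection `|x⟩⟨x|` of the fixed orthonormal basis. -/
def ketbra {X : Type*} [DecidableEq X] (x : X) : Matrix X X ℂ :=
  Matrix.single x x 1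

/-- The quantum-to-classical channel `ρ ↦ ∑ x, Tr (ρ |x⟩⟨x|) |x⟩⟨x|`. -/
def Nqc {X : Type*} [Fintype X] [DecidableEq X] (ρ : Matrix X X ℂ) : Matrix X X ℂ :=
  ∑ x, (ρ * ketbra x).trace • ketbra x

/-- The partial trace over the action space. -/
def partialTrace {X A : Type*} [Fintype A] (σ : Matrix (X × A) (X × A) ℂ) : Matrix X X ℂ :=
  Matrix.of fun x y => ∑ a, σ (x, a) (y, a)

/-- A quantum Markov decision process with state space `ℂ^X` and action space `ℂ^A` under the
discounted cost criterion. -/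
structure Model (X A : Type*) [Fintype X] [Fintype A] where
  /-- the state transition channel -/
  transition : Matrix (X × A) (X × A) ℂ →ₗ[ℂ] Matrix X X ℂ
  isChannel_transition : IsChannel transition
  /-- the one-stage cost operator -/
  cost : Matrix (X × A) (X × A) ℂ
  isHermitian_cost : cost.IsHermitian
  /-- the discount factor -/
  β : ℝ
  β_pos : 0 < β
  β_lt_one : β < 1

section Policies

variable (X A : Type*) [Fintype X] [DecidableEq X] [Fintype A]

/-- The set `C_w` of channels `γ` from `X` to `X ⊗ A` with `Tr_A (γ |x⟩⟨x|) = |x⟩⟨x|`. -/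
def Cw : Set (Matrix X X ℂ →ₗ[ℂ] Matrix (X × A) (X × A) ℂ) :=
  {γ | IsChannel γ ∧ ∀ x : X, partialTrace (γ (ketbra x)) = ketbra x}

/-- The set `Γ_w` of classical-state-preserving closed-loop policies. -/
def PolicySet : Set (ℕ → (Matrix X X ℂ →ₗ[ℂ] Matrix (X × A) (X × A) ℂ)) :=
  {γ | ∀ t, γ t ∈ Cw X A}

end Policies

namespace Model

variable {X A : Type*} [Fintype X] [Fintype A]

/-- The states `ρ_0 = ρ₀`, `ρ_{t+1} = N (γ_t ρ_t)`. -/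
def state (M : Model X A) (γ : ℕ → (Matrix X X ℂ →ₗ[ℂ] Matrix (X × A) (X × A) ℂ)) (ρ₀ : Matrix X X ℂ) :
    ℕ → Matrix X X ℂ
  | 0 => ρ₀
  | t + 1 => M.transition (γ t (state M γ ρ₀ t))

variable (M : Model X A)

/-- The actions `σ_t = γ_t ρ_t`. -/
def action (γ : ℕ → (Matrix X X ℂ →ₗ[ℂ] Matrix (X × A) (X × A) ℂ)) (ρ₀ : Matrix X X ℂ) (t : ℕ) :
    Matrix (X × A) (X × A) ℂ :=
  γ t (M.state γ ρ₀ t)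

/-- The discounted cost `V(γ, ρ₀) = ∑ t, β^t ⟨c, σ_t⟩`. -/
def discountedCost (γ : ℕ → (Matrix X X ℂ →ₗ[ℂ] Matrix (X × A) (X × A) ℂ))
    (ρ₀ : Matrix X X ℂ) : ℝ :=
  ∑' t, M.β ^ t * pairing M.cost (M.action γ ρ₀ t)

/-- The state occupation density operator `∑ t, (1 - β) β^t ρ_t`. -/
def stateOccupation (γ : ℕ → (Matrix X X ℂ →ₗ[ℂ] Matrix (X × A) (X × A) ℂ))
    (ρ₀ : Matrix X X ℂ) : Matrix X X ℂ :=
  ∑' t, ((1 - M.β) * M.β ^ t) • M.state γ ρ₀ t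

variable [DecidableEq X]

theorem isDensity_state {γ : ℕ → (Matrix X X ℂ →ₗ[ℂ] Matrix (X × A) (X × A) ℂ)}
    (hγ : γ ∈ PolicySet X A) {ρ₀ : Matrix X X ℂ} (h : IsDensity ρ₀) (t : ℕ) :
    IsDensity (M.state γ ρ₀ t) := by
  induction t with
  | zero => exact h
  | succ t ih => exact M.isChannel_transition.isDensity ((hγ t).1.isDensity ih)

/-- The series defining the discounted cost of a policy converges absolutely. -/
theorem summable_discountedCost {γ : ℕ → (Matrix X X ℂ →ₗ[ℂ] Matrix (X × A) (X × A) ℂ)}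
    (hγ : γ ∈ PolicySet X A) {ρ₀ : Matrix X X ℂ} (h : IsDensity ρ₀) :
    Summable fun t => M.β ^ t * pairing M.cost (M.action γ ρ₀ t) := by
  have hs := (summable_geometric_of_lt_one M.β_pos.le M.β_lt_one).mul_right
    (∑ i, ∑ j, ‖M.cost i j‖)
  refine hs.of_norm_bounded fun t => ?_
  have hd : IsDensity (M.action γ ρ₀ t) := (hγ t).1.isDensity (M.isDensity_state hγ h t)
  rw [norm_mul, norm_pow, Real.norm_of_nonneg M.β_pos.le]
  refine mul_le_mul_of_nonneg_left ?_ (pow_nonneg M.β_pos.le t)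
  refine (Complex.abs_re_le_norm _).trans ?_
  simp only [Matrix.trace, Matrix.diag_apply, Matrix.mul_apply]
  refine (norm_sum_le _ _).trans (Finset.sum_le_sum fun i _ => ?_)
  refine (norm_sum_le _ _).trans (Finset.sum_le_sum fun j _ => ?_)
  rw [norm_mul]
  exact mul_le_of_le_one_right (norm_nonneg _) (hd.norm_apply_le j i)

/-- The series defining the state occupation density operator of a policy converges. -/
theorem summable_stateOccupation {γ : ℕ → (Matrix X X ℂ →ₗ[ℂ] Matrix (X × A) (X × A) ℂ)}
    (hγ : γ ∈ PolicySet X A) {ρ₀ : Matrix X X ℂ} (h : IsDensity ρ₀) :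
    Summable fun t => ((1 - M.β) * M.β ^ t) • M.state γ ρ₀ t := by
  refine Pi.summable.2 fun i => Pi.summable.2 fun j => ?_
  have hs := (summable_geometric_of_lt_one M.β_pos.le M.β_lt_one).mul_left (1 - M.β)
  refine hs.of_norm_bounded fun t => ?_
  have h0 : 0 ≤ (1 - M.β) * M.β ^ t :=
    mul_nonneg (sub_nonneg.2 M.β_lt_one.le) (pow_nonneg M.β_pos.le t)
  rw [Matrix.smul_apply, norm_smul, Real.norm_of_nonneg h0]
  exact mul_le_of_le_one_right h0 ((M.isDensity_state hγ h t).norm_apply_le i j)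

/-- The optimal value `V_w^*(ρ₀)` over classical-state-preserving closed-loop policies. -/
def optimalValue (ρ₀ : Matrix X X ℂ) : ℝ :=
  sInf ((fun γ => M.discountedCost γ ρ₀) '' PolicySet X A)

/-- Optimality for `ρ₀` of a classical-state-preserving closed-loop policy: it attains the
minimal discounted cost among all such policies. -/
def IsOptimal (γ : ℕ → (Matrix X X ℂ →ₗ[ℂ] Matrix (X × A) (X × A) ℂ)) (ρ₀ : Matrix X X ℂ) : Prop :=
  γ ∈ PolicySet X A ∧ ∀ γ' ∈ PolicySet X A, M.discountedCost γ ρ₀ ≤ M.discountedCost γ' ρ₀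

/-- The set-valued map `R_w`: the minimizers over `C_w` of
`⟨c, γ'(ρ)⟩ + β ⟨N_qc ξ, N (γ'(ρ))⟩`, where `ρ` is the state occupation density operator of the
stationary policy `γ` started at `ρ₀`. -/
def Rw (ξ ρ₀ : Matrix X X ℂ) (γ : Matrix X X ℂ →ₗ[ℂ] Matrix (X × A) (X × A) ℂ) :
    Set (Matrix X X ℂ →ₗ[ℂ] Matrix (X × A) (X × A) ℂ) :=
  {γ₁ | γ₁ ∈ Cw X A ∧ IsMinOn
    (fun γ' : Matrix X X ℂ →ₗ[ℂ] Matrix (X × A) (X × A) ℂ =>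
      pairing M.cost (γ' (M.stateOccupation (fun _ => γ) ρ₀)) +
        M.β * pairing (Nqc ξ) (M.transition (γ' (M.stateOccupation (fun _ => γ) ρ₀))))
    (Cw X A) γ₁}

variable [DecidableEq A]

/-- Feasibility of `ξ` for the dual semidefinite program:
`ξ` is Hermitian and `c + β N†(N_qc ξ) ≽ N_qc ξ ⊗ Id`. -/
def DualFeasible (ξ : Matrix X X ℂ) : Prop :=
  ξ.IsHermitian ∧
    (M.cost + (M.β : ℂ) • adjoint M.transition (Nqc ξ) -
      Nqc ξ ⊗ₖ (1 : Matrix A A ℂ)).PosSemidef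

/-- The standing assumption on the model, for the operator `ξ`: it is dual feasible, and for each
density operator `ρ` the minimum over `γ ∈ C_w` of `⟨c + β N†(N_qc ξ), γ ρ⟩` is `⟨N_qc ξ, ρ⟩`. -/
def Certifies (ξ : Matrix X X ℂ) : Prop :=
  M.DualFeasible ξ ∧ ∀ ρ : Matrix X X ℂ, IsDensity ρ →
    IsLeast ((fun γ : Matrix X X ℂ →ₗ[ℂ] Matrix (X × A) (X × A) ℂ =>
      pairing (M.cost + (M.β : ℂ) • adjoint M.transition (Nqc ξ)) (γ ρ)) '' Cw X A)
      (pairing (Nqc ξ) ρ)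

end Model

end QMDP

end

/-! The proof is linear-programming duality. Let `S = c + β N†(N_qc ξ) - N_qc ξ ⊗ 1 ≽ 0` be the
slack (`dualSlack`). By positivity, a channel in `C_w` preserves the diagonal of every state, not
only of basis states (`partialTrace_apply_self`), so `⟨N_qc ξ ⊗ 1, γ ρ⟩ = ⟨N_qc ξ, ρ⟩`. The cost
then telescopes to `V(γ, ρ₀) = ⟨N_qc ξ, ρ₀⟩ + ∑ β^t ⟨S, σ_t⟩` (`hasSum_discountedCost`), which gives
the lower bound.

For attainment, a minimizer `γ` at the maximally mixed state satisfies `⟨S, γ 1⟩ = 0`. Every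
positive `ρ` lies below a multiple of `1`, so `⟨S, γ ρ⟩ = 0` for all of them. This one `γ` is
optimal from every initial state, and it is a fixed point of `R_w` because the objective there is
`⟨S, γ' ρ^γ⟩` plus a constant. No fixed-point theorem is needed; compactness of `C_w` is proved
separately. -/

namespace QMDP

open Matrix

/-! ### Positive matrices, positive functionals and bounds on channels. -/

section Positivity

variable {n m : Type*} [Fintype n] [Fintype m]

theorem pairing_add_left (A B C : Matrix n n ℂ) :
    pairing (A + B) C = pairing A C + pairing B C := by
  simp [pairing, Matrix.add_mul, Matrix.trace_add]

theorem pairing_smul_left (r : ℝ) (A B : Matrix n n ℂ) :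
    pairing ((r : ℂ) • A) B = r * pairing A B := by
  simp [pairing, Matrix.smul_mul, Matrix.trace_smul]

theorem pairing_sub_right (A B C : Matrix n n ℂ) :
    pairing A (B - C) = pairing A B - pairing A C := by
  simp [pairing, Matrix.mul_sub, Matrix.trace_sub]

theorem pairing_smul_right (r : ℝ) (A B : Matrix n n ℂ) :
    pairing A ((r : ℂ) • B) = r * pairing A B := by
  simp [pairing, Matrix.trace_smul]

open scoped MatrixOrder Matrix.Norms.L2Operator in
/-- The pairing of two positive semidefinite matrices is nonnegative. -/
theorem pairing_nonneg {A B : Matrix n n ℂ} (hA : A.PosSemidef) (hB : B.PosSemidef) :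
    0 ≤ pairing A B := by
  classical
  obtain ⟨C, rfl⟩ := CStarAlgebra.nonneg_iff_eq_star_mul_self.mp hA.nonneg
  have h := (hB.mul_mul_conjTranspose_same C).trace_nonneg
  rw [Matrix.trace_mul_comm, ← Matrix.mul_assoc] at h
  exact (Complex.le_def.mp h).1

open scoped MatrixOrder Matrix.Norms.L2Operator in
/-- A positive semidefinite matrix is dominated by a multiple of the identity. -/
theorem exists_posSemidef_smul_one_sub [DecidableEq n] {ρ : Matrix n n ℂ} (h : ρ.PosSemidef) :
    ∃ r : ℝ, ((r : ℂ) • (1 : Matrix n n ℂ) - ρ).PosSemidef := by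
  refine ⟨‖ρ‖, ?_⟩
  have h1 := IsSelfAdjoint.le_algebraMap_norm_self (a := ρ) h.1
  rw [Matrix.le_iff, Algebra.algebraMap_eq_smul_one] at h1
  simpa using h1

theorem IsChannel.posSemidef {Φ : Matrix n n ℂ →ₗ[ℂ] Matrix m m ℂ} (hΦ : IsChannel Φ)
    {ρ : Matrix n n ℂ} (h : ρ.PosSemidef) : (Φ ρ).PosSemidef :=
  (hΦ.completelyPositive 1 (ρ.submatrix Prod.fst Prod.fst) (h.submatrix _)).submatrix
    (fun i => (i, (0 : Fin 1)))

theorem isClosed_posSemidef : IsClosed {M : Matrix n n ℂ | M.PosSemidef} := by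
  simp only [Matrix.posSemidef_iff_dotProduct_mulVec, Set.ofPred_and, Set.ofPred_forall]
  refine IsClosed.inter (isClosed_eq (by fun_prop) continuous_id)
    (isClosed_iInter fun x => isClosed_le continuous_const (by fun_prop))

/-- A real affine function bounded below has slope zero. The order on `ℂ` also forces the imaginary
part to vanish for every `r`. -/
theorem eq_zero_of_forall_real_nonneg {a c : ℂ} (h : ∀ r : ℝ, 0 ≤ (r : ℂ) * a + c) : a = 0 := by
  have h' : ∀ r : ℝ, 0 ≤ r * a.re + c.re ∧ 0 = r * a.im + c.im := fun r => by
    simpa [Complex.le_def] using h r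
  refine Complex.ext ?_ ?_
  · by_contra h0
    have h1 := (h' (-(c.re + 1) / a.re)).1
    rw [div_mul_cancel₀ _ h0] at h1
    linarith
  · have h1 := (h' 0).2
    have h2 := (h' 1).2
    simp only [Complex.zero_im]
    linarith

/-- A positive functional vanishing at the matrix unit `E y y` vanishes at the off-diagonal matrix
units of row and column `y`. -/
theorem map_single_eq_zero_of_positive [DecidableEq n] {L : Matrix n n ℂ →ₗ[ℂ] ℂ}
    (hL : ∀ ρ : Matrix n n ℂ, ρ.PosSemidef → 0 ≤ L ρ) {y : n} (hy : L (single y y 1) = 0) (z : n) :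
    L (single y z 1) = 0 ∧ L (single z y 1) = 0 := by
  -- Test `L` on `v v*` with `v = s e_y + e_z`. The `|s|²` term drops out by `hy`, leaving an
  -- expression affine in `s`; real and imaginary `s` then kill the sum and the difference of the
  -- two off-diagonal values.
  have key : ∀ s : ℂ, 0 ≤ s * L (single y z 1) + star s * L (single z y 1) + L (single z z 1) := by
    intro s
    have h := hL _ (posSemidef_vecMulVec_self_star (s • Pi.single y (1 : ℂ) + Pi.single z 1))
    have e : vecMulVec (s • Pi.single y (1 : ℂ) + Pi.single z 1)
        (star (s • Pi.single y (1 : ℂ) + Pi.single z 1)) =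
        (s * star s) • single y y (1 : ℂ) + s • single y z (1 : ℂ) + star s • single z y (1 : ℂ)
          + single z z (1 : ℂ) := by
      ext i j
      simp only [vecMulVec_apply, Matrix.add_apply, Matrix.smul_apply, Matrix.single_apply,
        Pi.add_apply, Pi.smul_apply, Pi.star_apply, Pi.single_apply, smul_eq_mul, star_add,
        star_mul', ite_and, eq_comm (a := y), eq_comm (a := z)]
      split_ifs <;> simp <;> ring
    rw [e] at h
    simp only [map_add, map_smul, hy, smul_eq_mul, mul_zero, zero_add] at h
    exact h
  have h1 : L (single y z 1) + L (single z y 1) = 0 :=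
    eq_zero_of_forall_real_nonneg (c := L (single z z 1)) fun r => by
      have := key r
      rw [Complex.star_def, Complex.conj_ofReal] at this
      rwa [mul_add]
  have h2 : Complex.I * (L (single y z 1) - L (single z y 1)) = 0 :=
    eq_zero_of_forall_real_nonneg (c := L (single z z 1)) fun r => by
      have := key (r * Complex.I)
      simp only [Complex.star_def, map_mul, Complex.conj_ofReal, Complex.conj_I] at this
      convert this using 1
      ring
  have h3 := (mul_eq_zero.mp h2).resolve_left Complex.I_ne_zero
  constructor
  · linear_combination (h1 + h3) / 2
  · linear_combination (h1 - h3) / 2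

/-- The entries of a positive semidefinite matrix are bounded by its trace. -/
theorem norm_apply_le_trace {ρ : Matrix n n ℂ} (h : ρ.PosSemidef) (i j : n) :
    ‖ρ i j‖ ≤ ‖ρ.trace‖ := by
  by_cases h0 : ρ.trace = 0
  · simp [h.trace_eq_zero_iff.mp h0]
  have ht : 0 ≤ ρ.trace⁻¹ := by
    have := h.trace_nonneg
    positivity
  have hd : IsDensity (ρ.trace⁻¹ • ρ) :=
    ⟨h.smul ht, by rw [Matrix.trace_smul, smul_eq_mul, inv_mul_cancel₀ h0]⟩
  have := hd.norm_apply_le i j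
  rw [Matrix.smul_apply, norm_smul, norm_inv] at this
  rwa [inv_mul_le_iff₀ (norm_pos_iff.mpr h0), mul_one] at this

open scoped MatrixOrder Matrix.Norms.L2Operator in
/-- The entries of the values of channels at a given matrix are uniformly bounded. -/
theorem exists_forall_isChannel_norm_apply_le (ρ : Matrix n n ℂ) :
    ∃ C : ℝ, ∀ Φ : Matrix n n ℂ →ₗ[ℂ] Matrix m m ℂ, IsChannel Φ → ∀ i j, ‖Φ ρ i j‖ ≤ C := by
  classical
  -- Positive matrices span, and on each of them trace preservation gives a bound independent of the
  -- channel.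
  have hρ : ρ ∈ Submodule.span ℂ {a : Matrix n n ℂ | 0 ≤ a} := by
    rw [CStarAlgebra.span_nonneg]; trivial
  induction hρ using Submodule.span_induction with
  | mem x hx =>
    refine ⟨‖x.trace‖, fun Φ hΦ i j => ?_⟩
    rw [← hΦ.tracePreserving]
    exact norm_apply_le_trace (hΦ.posSemidef (Matrix.nonneg_iff_posSemidef.mp hx)) i j
  | zero => exact ⟨0, fun Φ _ i j => by simp⟩
  | add x y _ _ hx hy =>
    obtain ⟨a, ha⟩ := hx
    obtain ⟨b, hb⟩ := hy
    refine ⟨a + b, fun Φ hΦ i j => ?_⟩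
    rw [map_add, Matrix.add_apply]
    exact (norm_add_le _ _).trans (add_le_add (ha Φ hΦ i j) (hb Φ hΦ i j))
  | smul r x _ hx =>
    obtain ⟨a, ha⟩ := hx
    refine ⟨‖r‖ * a, fun Φ hΦ i j => ?_⟩
    rw [map_smul, Matrix.smul_apply, norm_smul]
    exact mul_le_mul_of_nonneg_left (ha Φ hΦ i j) (norm_nonneg r)

end Positivity

/-! ### Geometry of `C_w` and preservation of the diagonal. -/

section ClassicalStatePreserving

variable {X A : Type*} [Fintype X] [DecidableEq X] [Fintype A]

theorem convex_Cw : Convex ℝ (Cw X A) := by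
  rintro γ ⟨hγ, hγ'⟩ δ ⟨hδ, hδ'⟩ a b ha hb hab
  have hab' : (a : ℂ) + b = 1 := by exact_mod_cast hab
  refine ⟨⟨fun k M hM => ?_, fun M => ?_⟩, fun x => ?_⟩
  · have e : ampliation (a • γ + b • δ) k M = a • ampliation γ k M + b • ampliation δ k M := rfl
    rw [e]
    exact ((hγ.completelyPositive k M hM).smul ha).add ((hδ.completelyPositive k M hM).smul hb)
  · rw [LinearMap.add_apply, LinearMap.smul_apply, LinearMap.smul_apply, Matrix.trace_add,
      Matrix.trace_smul, Matrix.trace_smul, hγ.tracePreserving, hδ.tracePreserving, ← add_smul,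
      hab, one_smul]
  · have e : partialTrace ((a • γ + b • δ) (ketbra x)) =
        a • partialTrace (γ (ketbra x)) + b • partialTrace (δ (ketbra x)) := by
      ext i j
      simp [partialTrace, Finset.sum_add_distrib, Finset.mul_sum]
    rw [e, hγ', hδ', ← add_smul, hab, one_smul]

/-- The topology is pointwise convergence, the usual one on a finite-dimensional space of linear
maps. Tychonoff gives a compact box from the uniform entry bounds, and every defining condition,
linearity included, is closed under pointwise limits. -/
theorem isCompact_coe_image_Cw :
    IsCompact ((fun γ : Matrix X X ℂ →ₗ[ℂ] Matrix (X × A) (X × A) ℂ =>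
      (γ : Matrix X X ℂ → Matrix (X × A) (X × A) ℂ)) '' Cw X A) := by
  choose C hC using exists_forall_isChannel_norm_apply_le (n := X) (m := X × A)
  have hK : IsCompact (Set.univ.pi fun ρ : Matrix X X ℂ =>
      (Set.univ.pi fun _ : X × A => Set.univ.pi fun _ : X × A => Metric.closedBall (0 : ℂ) (C ρ) :
        Set (Matrix (X × A) (X × A) ℂ))) :=
    isCompact_univ_pi fun ρ => isCompact_univ_pi fun _ => isCompact_univ_pi fun _ =>
      isCompact_closedBall _ _
  refine hK.of_isClosed_subset ?_ ?_
  · have e : ((fun γ : Matrix X X ℂ →ₗ[ℂ] Matrix (X × A) (X × A) ℂ =>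
        (γ : Matrix X X ℂ → Matrix (X × A) (X × A) ℂ)) '' Cw X A) =
        {f | (∀ ρ σ, f (ρ + σ) = f ρ + f σ) ∧ (∀ (a : ℂ) ρ, f (a • ρ) = a • f ρ) ∧
          (∀ (k : ℕ) (M : Matrix (X × Fin k) (X × Fin k) ℂ), M.PosSemidef →
            (Matrix.of fun p q : (X × A) × Fin k =>
              f (Matrix.of fun i j => M (i, p.2) (j, q.2)) p.1 q.1).PosSemidef) ∧
          (∀ ρ, (f ρ).trace = ρ.trace) ∧ ∀ x, partialTrace (f (ketbra x)) = ketbra x} := by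
      ext f
      constructor
      · rintro ⟨γ, ⟨hγ, hγ'⟩, rfl⟩
        exact ⟨map_add γ, map_smul γ, hγ.completelyPositive, hγ.tracePreserving, hγ'⟩
      · rintro ⟨h1, h2, h3, h4, h5⟩
        exact ⟨⟨⟨f, h1⟩, h2⟩, ⟨⟨h3, h4⟩, h5⟩, rfl⟩
    rw [e]
    simp only [Set.ofPred_and, Set.ofPred_forall]
    refine IsClosed.inter ?_ (IsClosed.inter ?_ (IsClosed.inter ?_ (IsClosed.inter ?_ ?_)))
    · exact isClosed_iInter fun ρ => isClosed_iInter fun σ =>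
        isClosed_eq (by fun_prop) (by fun_prop)
    · exact isClosed_iInter fun a => isClosed_iInter fun ρ =>
        isClosed_eq (by fun_prop) (by fun_prop)
    · refine isClosed_iInter fun k => isClosed_iInter fun M => isClosed_iInter fun _ =>
        isClosed_posSemidef.preimage (continuous_matrix fun p q => ?_)
      exact (continuous_apply _).matrix_elem p.1 q.1
    · exact isClosed_iInter fun ρ =>
        isClosed_eq (continuous_apply ρ).matrix_trace continuous_const
    · refine isClosed_iInter fun x => isClosed_eq (continuous_matrix fun p q => ?_) continuous_const
      exact continuous_finsetSum _ fun a _ => (continuous_apply _).matrix_elem _ _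
  · rintro _ ⟨γ, hγ, rfl⟩ ρ - i - j -
    simpa using hC ρ γ hγ.1 i j

/-- Channels in `C_w` preserve the diagonal of the state. -/
theorem partialTrace_apply_self {γ : Matrix X X ℂ →ₗ[ℂ] Matrix (X × A) (X × A) ℂ}
    (hγ : γ ∈ Cw X A) (ρ : Matrix X X ℂ) (x : X) : partialTrace (γ ρ) x x = ρ x x := by
  -- `L` is a positive functional equal to `δ_{xy}` at `E y y`. A matrix unit other than `E x x` has
  -- an index different from `x`, so `map_single_eq_zero_of_positive` or `hd` makes `L` vanish
  -- there.
  let L : Matrix X X ℂ →ₗ[ℂ] ℂ :=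
    { toFun := fun ρ => ∑ a, γ ρ (x, a) (x, a)
      map_add' := fun ρ σ => by simp [Finset.sum_add_distrib]
      map_smul' := fun r ρ => by simp [Finset.mul_sum] }
  have hL : ∀ ρ : Matrix X X ℂ, ρ.PosSemidef → 0 ≤ L ρ := fun ρ h =>
    Finset.sum_nonneg fun a _ => (hγ.1.posSemidef h).diag_nonneg
  have hd : ∀ y, L (single y y 1) = if y = x then 1 else 0 := fun y => by
    have h := congrFun (congrFun (hγ.2 y) x) x
    simp only [ketbra, Matrix.single_apply, and_self] at h
    exact h
  have ho : ∀ y z, L (single y z 1) = if y = x ∧ z = x then 1 else 0 := fun y z => by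
    by_cases hy : y = x
    · by_cases hz : z = x
      · subst hy hz; simp [hd]
      · rw [if_neg fun h => hz h.2]
        exact (map_single_eq_zero_of_positive hL (by rw [hd, if_neg hz]) y).2
    · rw [if_neg fun h => hy h.1]
      exact (map_single_eq_zero_of_positive hL (by rw [hd, if_neg hy]) z).1
  change L ρ = ρ x x
  conv_lhs => rw [Matrix.matrix_eq_sum_single ρ]
  have e : ∀ i j, L (single i j (ρ i j)) = ρ i j * L (single i j 1) := fun i j => by
    rw [← smul_eq_mul, ← map_smul, Matrix.smul_single, smul_eq_mul, mul_one]
  simp only [map_sum, e, ho, mul_ite, mul_one, mul_zero, ite_and]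
  simp

theorem Nqc_eq_diagonal (ρ : Matrix X X ℂ) : Nqc ρ = diagonal fun x => ρ x x := by
  ext i j
  simp only [Nqc, ketbra, Matrix.sum_apply, Matrix.smul_apply, Matrix.single_apply,
    Matrix.diagonal_apply, Matrix.trace_mul_single, ite_and]
  simp

theorem isHermitian_Nqc {ξ : Matrix X X ℂ} (h : ξ.IsHermitian) : (Nqc ξ).IsHermitian := by
  rw [Nqc_eq_diagonal]
  exact Matrix.isHermitian_diagonal_iff.mpr fun x => h.apply x x

variable [DecidableEq A]

/-- The operator is diagonal with entries independent of the action, so it sees only the diagonal of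
the partial trace, which `γ` preserves. -/
theorem pairing_Nqc_kronecker_one (ξ : Matrix X X ℂ)
    {γ : Matrix X X ℂ →ₗ[ℂ] Matrix (X × A) (X × A) ℂ} (hγ : γ ∈ Cw X A) (ρ : Matrix X X ℂ) :
    pairing (Nqc ξ ⊗ₖ (1 : Matrix A A ℂ)) (γ ρ) = pairing (Nqc ξ) ρ := by
  rw [pairing, pairing, Nqc_eq_diagonal, ← Matrix.diagonal_one,
    Matrix.diagonal_kronecker_diagonal]
  simp only [Matrix.trace, Matrix.diag_apply, Matrix.diagonal_mul, mul_one,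
    Fintype.sum_prod_type, ← Finset.mul_sum]
  congr 1
  exact Finset.sum_congr rfl fun x _ => congrArg _ (partialTrace_apply_self hγ ρ x)

end ClassicalStatePreserving

/-! ### Duality: telescoping, the lower bound and its attainment. -/

namespace Model

variable {X A : Type*} [Fintype X] [DecidableEq X] [Fintype A]
  {M : Model X A}

theorem posSemidef_stateOccupation
    {γ : ℕ → (Matrix X X ℂ →ₗ[ℂ] Matrix (X × A) (X × A) ℂ)} (hγ : γ ∈ PolicySet X A)
    {ρ₀ : Matrix X X ℂ} (h₀ : IsDensity ρ₀) : (M.stateOccupation γ ρ₀).PosSemidef := by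
  refine isClosed_posSemidef.mem_of_tendsto (M.summable_stateOccupation hγ h₀).hasSum
    (Filter.Eventually.of_forall fun s => ?_)
  exact Matrix.posSemidef_sum s fun t _ => (M.isDensity_state hγ h₀ t).1.smul
    (mul_nonneg (sub_nonneg.2 M.β_lt_one.le) (pow_nonneg M.β_pos.le t))

variable [DecidableEq A] (M)

/-- The slack `c + β N†(N_qc ξ) - N_qc ξ ⊗ Id` of the dual constraint. -/
def dualSlack (ξ : Matrix X X ℂ) : Matrix (X × A) (X × A) ℂ :=
  M.cost + (M.β : ℂ) • adjoint M.transition (Nqc ξ) - Nqc ξ ⊗ₖ (1 : Matrix A A ℂ)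

variable {M} {ξ : Matrix X X ℂ}

/-- Read off from the dual constraint: the slack, the cost and `N_qc ξ ⊗ 1` are Hermitian, and `β`
is real and nonzero. -/
theorem DualFeasible.isHermitian_adjoint (h : M.DualFeasible ξ) :
    (adjoint M.transition (Nqc ξ)).IsHermitian := by
  have hβ : (M.β : ℂ) ≠ 0 := by exact_mod_cast M.β_pos.ne'
  have h1 := ((h.2.1.add (show (Nqc ξ ⊗ₖ (1 : Matrix A A ℂ)).IsHermitian by
    rw [Matrix.IsHermitian, Matrix.conjTranspose_kronecker, (isHermitian_Nqc h.1).eq,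
      Matrix.conjTranspose_one])).sub M.isHermitian_cost)
  rw [sub_add_cancel, add_sub_cancel_left] at h1
  have h2 : ((M.β : ℂ) • adjoint M.transition (Nqc ξ)).conjTranspose = _ := h1
  rw [Matrix.conjTranspose_smul, Complex.star_def, Complex.conj_ofReal] at h2
  exact smul_right_injective _ hβ h2

theorem DualFeasible.pairing_adjoint (h : M.DualFeasible ξ) (σ : Matrix (X × A) (X × A) ℂ) :
    pairing (adjoint M.transition (Nqc ξ)) σ = pairing (Nqc ξ) (M.transition σ) := by
  have := trace_adjoint M.transition (Nqc ξ) σ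
  rw [h.isHermitian_adjoint.eq, (isHermitian_Nqc h.1).eq] at this
  rw [pairing, this, pairing]

/-- The cost plus the discounted value of the next state is the value of the current state plus the
pairing with the dual slack. -/
theorem DualFeasible.cost_add_eq (h : M.DualFeasible ξ)
    {γ : Matrix X X ℂ →ₗ[ℂ] Matrix (X × A) (X × A) ℂ} (hγ : γ ∈ Cw X A) (ρ : Matrix X X ℂ) :
    pairing M.cost (γ ρ) + M.β * pairing (Nqc ξ) (M.transition (γ ρ)) =
      pairing (M.dualSlack ξ) (γ ρ) + pairing (Nqc ξ) ρ := by
  rw [← pairing_Nqc_kronecker_one ξ hγ ρ, ← pairing_add_left, dualSlack, sub_add_cancel,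
    pairing_add_left, pairing_smul_left, h.pairing_adjoint]

/-- Some channel in `C_w` annihilates the dual slack at every state. -/
theorem Certifies.exists_pairing_dualSlack_eq_zero [Nonempty X] (h : M.Certifies ξ) :
    ∃ γ ∈ Cw X A, ∀ ρ : Matrix X X ℂ, ρ.PosSemidef → pairing (M.dualSlack ξ) (γ ρ) = 0 := by
  have hc : (0 : ℝ) < (Fintype.card X : ℝ)⁻¹ := by
    have := Fintype.card_pos (α := X); positivity
  -- The maximally mixed state: it has full rank, so vanishing slack there propagates to every
  -- state.
  have hd : IsDensity ((((Fintype.card X : ℝ)⁻¹ : ℝ) : ℂ) • (1 : Matrix X X ℂ)) := by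
    refine ⟨Matrix.PosSemidef.one.smul (by exact_mod_cast hc.le), ?_⟩
    rw [Matrix.trace_smul, Matrix.trace_one]
    simp
  obtain ⟨γ, hγ, e⟩ := (h.2 _ hd).1
  have h1 : pairing (M.dualSlack ξ) (γ 1) = 0 := by
    have h2 := h.1.cost_add_eq hγ ((((Fintype.card X : ℝ)⁻¹ : ℝ) : ℂ) • (1 : Matrix X X ℂ))
    simp only [pairing_add_left, pairing_smul_left, h.1.pairing_adjoint] at e
    rw [e, right_eq_add, map_smul, pairing_smul_right] at h2
    exact (mul_eq_zero.mp h2).resolve_left hc.ne'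
  refine ⟨γ, hγ, fun ρ hρ => ?_⟩
  -- Squeeze: `0 ≤ ⟨S, γ ρ⟩ ≤ r ⟨S, γ 1⟩ = 0`.
  obtain ⟨r, hr⟩ := exists_posSemidef_smul_one_sub hρ
  refine le_antisymm ?_ (pairing_nonneg h.1.2 (hγ.1.posSemidef hρ))
  have h3 : 0 ≤ pairing (M.dualSlack ξ) _ := pairing_nonneg h.1.2 (hγ.1.posSemidef hr)
  rw [map_sub, map_smul, pairing_sub_right, pairing_smul_right, h1] at h3
  linarith

/-- The discounted cost is the dual value of the initial state plus the discounted pairings with the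
dual slack. -/
theorem DualFeasible.hasSum_discountedCost (h : M.DualFeasible ξ)
    {γ : ℕ → (Matrix X X ℂ →ₗ[ℂ] Matrix (X × A) (X × A) ℂ)} (hγ : γ ∈ PolicySet X A)
    {ρ₀ : Matrix X X ℂ} (h₀ : IsDensity ρ₀) :
    HasSum (fun t => M.β ^ t * pairing (M.dualSlack ξ) (M.action γ ρ₀ t))
      (M.discountedCost γ ρ₀ - pairing (Nqc ξ) ρ₀) := by
  have hv : Summable fun t => M.β ^ t * pairing (Nqc ξ) (M.state γ ρ₀ t) := by
    have hs := (summable_geometric_of_lt_one M.β_pos.le M.β_lt_one).mul_right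
      (∑ i, ∑ j, ‖Nqc ξ i j‖)
    refine hs.of_norm_bounded fun t => ?_
    rw [norm_mul, norm_pow, Real.norm_of_nonneg M.β_pos.le]
    refine mul_le_mul_of_nonneg_left ?_ (pow_nonneg M.β_pos.le t)
    refine (Complex.abs_re_le_norm _).trans ?_
    simp only [Matrix.trace, Matrix.diag_apply, Matrix.mul_apply]
    refine (norm_sum_le _ _).trans (Finset.sum_le_sum fun i _ => ?_)
    refine (norm_sum_le _ _).trans (Finset.sum_le_sum fun j _ => ?_)
    rw [norm_mul]
    exact mul_le_of_le_one_right (norm_nonneg _)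
      ((M.isDensity_state hγ h₀ t).norm_apply_le j i)
  -- The shifted value series lacks its `t = 0` term, and this is what survives the telescoping.
  have hv' := (hasSum_nat_add_iff' 1).mpr hv.hasSum
  have := ((M.summable_discountedCost hγ h₀).hasSum.add hv').sub hv.hasSum
  have e : (fun t => M.β ^ t * pairing (M.dualSlack ξ) (M.action γ ρ₀ t)) = fun t =>
      M.β ^ t * pairing M.cost (M.action γ ρ₀ t) +
        M.β ^ (t + 1) * pairing (Nqc ξ) (M.state γ ρ₀ (t + 1)) -
        M.β ^ t * pairing (Nqc ξ) (M.state γ ρ₀ t) := by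
    funext t
    have e := h.cost_add_eq (hγ t) (M.state γ ρ₀ t)
    rw [state, pow_succ, action]
    linear_combination -(M.β ^ t) * e
  have e' : M.discountedCost γ ρ₀ - pairing (Nqc ξ) ρ₀ =
      ∑' t, M.β ^ t * pairing M.cost (M.action γ ρ₀ t) +
        (∑' t, M.β ^ t * pairing (Nqc ξ) (M.state γ ρ₀ t) -
          ∑ i ∈ Finset.range 1, M.β ^ i * pairing (Nqc ξ) (M.state γ ρ₀ i)) -
      ∑' t, M.β ^ t * pairing (Nqc ξ) (M.state γ ρ₀ t) := by
    rw [Finset.sum_range_one, state, pow_zero, one_mul, discountedCost]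
    ring
  rw [e, e']
  exact this

theorem DualFeasible.le_discountedCost (h : M.DualFeasible ξ)
    {γ : ℕ → (Matrix X X ℂ →ₗ[ℂ] Matrix (X × A) (X × A) ℂ)} (hγ : γ ∈ PolicySet X A)
    {ρ₀ : Matrix X X ℂ} (h₀ : IsDensity ρ₀) :
    pairing (Nqc ξ) ρ₀ ≤ M.discountedCost γ ρ₀ :=
  sub_nonneg.mp <| (h.hasSum_discountedCost hγ h₀).nonneg fun t =>
    mul_nonneg (pow_nonneg M.β_pos.le t) <|
      pairing_nonneg h.2 ((hγ t).1.isDensity (M.isDensity_state hγ h₀ t)).1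

/-- One channel in `C_w` is, as a stationary policy, of cost `⟨N_qc ξ, ρ₀⟩` and a fixed point of
`R_w` for every initial state `ρ₀`. -/
theorem Certifies.exists_stationary [Nonempty X] (h : M.Certifies ξ) :
    ∃ γ ∈ Cw X A, ∀ ρ₀ : Matrix X X ℂ, IsDensity ρ₀ →
      M.discountedCost (fun _ => γ) ρ₀ = pairing (Nqc ξ) ρ₀ ∧ γ ∈ M.Rw ξ ρ₀ γ := by
  obtain ⟨γ, hγ, hz⟩ := h.exists_pairing_dualSlack_eq_zero
  have hp : (fun _ => γ) ∈ PolicySet X A := fun _ => hγ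
  refine ⟨γ, hγ, fun ρ₀ h₀ => ⟨?_, hγ, fun γ' hγ' => ?_⟩⟩
  · have hs := h.1.hasSum_discountedCost hp h₀
    have e : (fun t => M.β ^ t * pairing (M.dualSlack ξ) (M.action (fun _ => γ) ρ₀ t)) =
        fun _ => 0 :=
      funext fun t => by rw [action, hz _ (M.isDensity_state hp h₀ t).1, mul_zero]
    rw [e] at hs
    exact sub_eq_zero.mp (hs.unique hasSum_zero)
  · have hρ := posSemidef_stateOccupation (M := M) hp h₀
    -- The occupation state depends on `γ` alone, so both objectives share the term `⟨N_qc ξ, ρ^γ⟩`;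
    -- the slack term is zero for `γ` and nonnegative for `γ'`.
    simp only [Set.mem_ofPred_eq, h.1.cost_add_eq hγ, h.1.cost_add_eq hγ', hz _ hρ]
    exact add_le_add_left (pairing_nonneg h.1.2 (hγ'.1.posSemidef hρ)) _

end Model

end QMDP

theorem mainTheorem2 {X A : Type*} [Fintype X] [DecidableEq X] [Fintype A] [DecidableEq A]
    (M : QMDP.Model X A) (ξ : Matrix X X ℂ) (hξ : M.Certifies ξ) :
    (∀ ρ : Matrix X X ℂ, QMDP.IsDensity ρ →
      M.optimalValue ρ = QMDP.pairing (QMDP.Nqc ξ) ρ) ∧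
    Convex ℝ (QMDP.Cw X A) ∧
    IsCompact ((fun γ : Matrix X X ℂ →ₗ[ℂ] Matrix (X × A) (X × A) ℂ =>
      (γ : Matrix X X ℂ → Matrix (X × A) (X × A) ℂ)) '' QMDP.Cw X A) ∧
    ∀ ρ₀ : Matrix X X ℂ, QMDP.IsDensity ρ₀ →
      ∃ γ ∈ QMDP.Cw X A, γ ∈ M.Rw ξ ρ₀ γ ∧ M.IsOptimal (fun _ => γ) ρ₀ := by
  -- The maximally mixed state needs `X` nonempty, which trace one guarantees.
  have key : ∀ ρ₀ : Matrix X X ℂ, QMDP.IsDensity ρ₀ → Nonempty X := fun ρ₀ h₀ => by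
    by_contra hX
    rw [not_nonempty_iff] at hX
    simpa [Matrix.trace] using h₀.2
  refine ⟨fun ρ hρ => ?_, QMDP.convex_Cw, QMDP.isCompact_coe_image_Cw, fun ρ₀ h₀ => ?_⟩
  · have := key ρ hρ
    obtain ⟨γ, hγ, hs⟩ := hξ.exists_stationary
    refine IsLeast.csInf_eq ⟨⟨fun _ => γ, fun _ => hγ, (hs ρ hρ).1⟩, ?_⟩
    rintro _ ⟨γ', hγ', rfl⟩
    exact hξ.1.le_discountedCost hγ' hρ
  · have := key ρ₀ h₀
    obtain ⟨γ, hγ, hs⟩ := hξ.exists_stationary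
    refine ⟨γ, hγ, (hs ρ₀ h₀).2, fun _ => hγ, fun γ' hγ' => ?_⟩
    rw [(hs ρ₀ h₀).1]
    exact hξ.1.le_discountedCost hγ' h₀
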